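/- Let $n\in\mathbb N$, and let $\mathcal S(\mathbb C^{2^n})$ be the set of positive semidefinite operators of trace $1$ on $\mathcal H=\mathbb C^{2^n}=(\mathbb C^2)^{\otimes n}$. For $\rho,\omega\in\mathcal S(\mathcal H)$ let $\mathcal C(\rho,\omega)$ be the set of quantum couplings, i.e. of states $\Pi$ on $\mathcal H\otimes\mathcal H^*$ with partial traces $\mathrm{tr}_{\mathcal H^*}[\Pi]=\omega$ and $\mathrm{tr}_{\mathcal H}[\Pi]=\rho^T$, where $A^T:\mathcal H^*\to\mathcal H^*$ denotes the transpose (dual map) of an operator $A$ on $\mathcal H$. Let $\sigma_0=I$ and let $\sigma_1,\sigma_2,\sigma_3$ be the Pauli matrices on $\mathbb C^2$; put $\sigma_m=\bigotimes_{i=1}^n\sigma_{m(i)}$ for $m\in\{0,1,2,3\}^{\{1,\dots,n\}}$, $$C_{\mathrm{sym},n}=\sum_{m\in\{0,1,2,3\}^{\{1,\dots,n\}}}\bigl(\sigma_m\otimes I^T-I\otimes\sigma_m^T\bigr)^2,$$ and $$D_{\mathrm{sym},n}(\rho,\omega)=\Bigl(\inf\bigl\{\mathrm{tr}[\Pi\,C_{\mathrm{sym},n}]\;:\;\Pi\in\mathcal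 C(\rho,\omega)\bigr\}\Bigr)^{1/2}.$$ Theorem. For a map $\Phi:\mathcal S(\mathbb C^{2^n})\to\mathcal S(\mathbb C^{2^n})$ (not assumed to be surjective, injective or continuous) the following are equivalent: 1. $D_{\mathrm{sym},n}(\Phi(\rho),\Phi(\omega))=D_{\mathrm{sym},n}(\rho,\omega)$ for all $\rho,\omega\in\mathcal S(\mathbb C^{2^n})$; 2. $\Phi$ is a Wigner symmetry, that is, there is a unitary or anti-unitary operator $U:\mathbb C^{2^n}\to\mathbb C^{2^n}$ such that $\Phi(\rho)=U\rho U^*$ for all $\rho\in\mathcal S(\mathbb C^{2^n})$. -/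

import Mathlib

open scoped ComplexOrder Kronecker Matrix

noncomputable section

namespace QubitWasserstein

/-- The index set of the computational basis of `ℂ^(2^n) = (ℂ²)^{⊗ n}`: bit strings of
length `n`. -/
abbrev Bits (n : ℕ) : Type := Fin n → Fin 2

/-- The `n`-qubit Hilbert space `ℂ^(2^n)`, with its standard inner product. -/
abbrev QubitSpace (n : ℕ) : Type := EuclideanSpace ℂ (Bits n)

section General

variable {ι : Type} [Fintype ι] [DecidableEq ι] {κ : Type} [Fintype κ]

/-- The state space `S(ℂ^ι)`: positive semidefinite matrices of unit trace. -/
def State (ι : Type) [Fintype ι] : Type :=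
  {ρ : Matrix ι ι ℂ // ρ.PosSemidef ∧ ρ.trace = 1}

/-- The operator on `ℂ^ι` given by a state. -/
def State.op (ρ : State ι) : EuclideanSpace ℂ ι →ₗ[ℂ] EuclideanSpace ℂ ι :=
  Matrix.toEuclideanLin ρ.1

/-- Partial trace over the second tensor factor. -/
def partialTraceSnd (P : Matrix (ι × ι) (ι × ι) ℂ) : Matrix ι ι ℂ :=
  Matrix.of fun i i' => ∑ j, P (i, j) (i', j)

/-- Partial trace over the first tensor factor. -/
def partialTraceFst (P : Matrix (ι × ι) (ι × ι) ℂ) : Matrix ι ι ℂ :=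
  Matrix.of fun j j' => ∑ i, P (i, j) (i, j')

/-- The quantum couplings of `ρ` and `ω`: the states on `H ⊗ H*` (`H = ℂ^ι`) whose marginal on
`H` is `ω` and whose marginal on `H*` is `ρᵀ`. Operators on `H ⊗ H*` are written as matrices in
the product of the standard basis of `H` and its dual basis of `H*`; in these bases the transpose
`Aᵀ : H* → H*` of an operator `A` on `H` is the transposed matrix. -/
def couplings (ρ ω : State ι) : Set (State (ι × ι)) :=
  {P | partialTraceSnd P.1 = ω.1 ∧ partialTraceFst P.1 = ρ.1ᵀ}

/-- The quadratic transport cost operator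
`C_A = ∑ₖ (Aₖ ⊗ Iᵀ - I ⊗ Aₖᵀ)²` of a finite family `A` of observables. -/
def costOperator (A : κ → Matrix ι ι ℂ) : Matrix (ι × ι) (ι × ι) ℂ :=
  ∑ k, (A k ⊗ₖ (1 : Matrix ι ι ℂ)ᵀ - (1 : Matrix ι ι ℂ) ⊗ₖ (A k)ᵀ) ^ 2

/-- The cost `tr (Π C_A)` of a coupling `Π`; for Hermitian observables this trace is a
nonnegative real number. -/
def cost (A : κ → Matrix ι ι ℂ) (P : State (ι × ι)) : ℝ :=
  (P.1 * costOperator A).trace.re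

/-- The quadratic quantum Wasserstein distance
`D_A(ρ, ω) = (inf {Cost_A(Π) : Π a coupling of ρ and ω})^(1/2)`. -/
def wassersteinDist (A : κ → Matrix ι ι ℂ) (ρ ω : State ι) : ℝ :=
  Real.sqrt (sInf (cost A '' couplings ρ ω))

end General

/-- The Pauli matrices `σ₀ = I, σ₁ = σ_x, σ₂ = σ_y, σ₃ = σ_z`. -/
def pauli : Fin 4 → Matrix (Fin 2) (Fin 2) ℂ :=
  ![!![1, 0; 0, 1], !![0, 1; 1, 0], !![0, -Complex.I; Complex.I, 0], !![1, 0; 0, -1]]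

/-- The tensor product `σ_{m(1)} ⊗ ⋯ ⊗ σ_{m(n)}`, as a matrix in the computational basis. -/
def pauliTensor {n : ℕ} (m : Fin n → Fin 4) : Matrix (Bits n) (Bits n) ℂ :=
  Matrix.of fun x y => ∏ i, pauli (m i) (x i) (y i)

/-- The symmetric quantum Wasserstein distance `D_{sym,n}` on `n`-qubit states: the observables
are all `4^n` tensor products of Pauli matrices. -/
def symDist (n : ℕ) (ρ ω : State (Bits n)) : ℝ :=
  wassersteinDist (pauliTensor (n := n)) ρ ω

/-- `Φ` is a Wigner symmetry: `Φ(ρ) = U ρ U*` for all states `ρ`, with `U` unitary (a bijective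
linear isometry) or anti-unitary (a bijective conjugate-linear isometry). In both cases the
adjoint `U*` is the inverse `U.symm`. -/
def IsWignerSymmetry {n : ℕ} (Φ : State (Bits n) → State (Bits n)) : Prop :=
  (∃ U : QubitSpace n ≃ₗᵢ[ℂ] QubitSpace n,
      ∀ ρ : State (Bits n), ∀ x : QubitSpace n, (Φ ρ).op x = U (ρ.op (U.symm x))) ∨
  (∃ U : QubitSpace n ≃ₗᵢ⋆[ℂ] QubitSpace n,
      ∀ ρ : State (Bits n), ∀ x : QubitSpace n, (Φ ρ).op x = U (ρ.op (U.symm x)))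

end QubitWasserstein

end

namespace QubitWasserstein

/-! ### Products and completeness of the Pauli tensors -/

section Pauli

/-! The Pauli tensors square to the identity and satisfy a completeness relation, so the cost
operator is `2·4ⁿ·I - 2·2ⁿ·|Ω⟩⟨Ω|` with `Ω = ∑ᵢ eᵢ ⊗ eᵢ`. Minimising the cost therefore means
maximising the overlap `⟨Ω, Π Ω⟩` (`cost_pauliTensor`).

A pure state `ρ` has only the product coupling with `ω` (`eq_productCoupling_of_isPure`), whose
overlap is `tr(ρω)`; hence distances from pure states encode all the numbers `tr(ρω)`. Purity itself
is visible in the self-distance: a Hermitian square root `S` of `ρ` gives a self-coupling of overlap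
`|tr S|²`. For the positive root this is at least `1`, with equality only for pure states
(`isPure_of_overlap_le`). An isometry thus preserves purity and the overlaps of pure states with all
states.

What remains is a Wigner theorem without surjectivity. Images of the basis projections are
orthogonal rank-one projections, so a unitary change of basis makes the map preserve diagonals.
Testing on `e_o + z e_j` shows that each entry of row `o` is, up to a phase, kept or conjugated;
testing on `e_o + z e_i + z e_j` shows that the choice is the same for all entries. Row `o`
determines a pure state with nonzero `(o, o)` entry, and overlaps with such states determine every
state.

Conversely, `W ⊗ W̄` fixes `Ω` for unitary `W`, and transposition preserves overlaps; both carry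
couplings to couplings, so Wigner symmetries preserve the distance. -/

lemma pauli_sum_mul_apply (a b c e : Fin 2) :
    ∑ k, pauli k a b * pauli k c e = if a = e ∧ b = c then 2 else 0 := by
  fin_cases a <;> fin_cases b <;> fin_cases c <;> fin_cases e <;>
    simp [pauli, Fin.sum_univ_four] <;> norm_num

lemma pauli_mul_self_apply (k : Fin 4) (a b : Fin 2) :
    ∑ c, pauli k a c * pauli k c b = if a = b then 1 else 0 := by
  fin_cases k <;> fin_cases a <;> fin_cases b <;> simp [pauli]

lemma pauli_conj_apply (k : Fin 4) (a b : Fin 2) : star (pauli k b a) = pauli k a b := by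
  fin_cases k <;> fin_cases a <;> fin_cases b <;> simp [pauli]

variable {n : ℕ}

lemma pauliTensor_mul_self (m : Fin n → Fin 4) : pauliTensor m * pauliTensor m = 1 := by
  ext x y
  simp only [Matrix.mul_apply, pauliTensor, Matrix.of_apply, ← Finset.prod_mul_distrib]
  rw [← Fintype.prod_sum (fun i c => pauli (m i) (x i) c * pauli (m i) c (y i))]
  simp only [pauli_mul_self_apply, Matrix.one_apply, Finset.prod_ite_zero, Finset.prod_const_one,
    funext_iff, Finset.mem_univ, true_imp_iff]

lemma pauliTensor_isHermitian (m : Fin n → Fin 4) : (pauliTensor m).IsHermitian := by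
  ext x y
  simp only [Matrix.conjTranspose_apply, pauliTensor, Matrix.of_apply, star_prod, pauli_conj_apply]

/-- Completeness: the sum of `σ_m ⊗ σ_m` is `2ⁿ` times the swap, qubit by qubit. Transposing the
second factor turns the swap into `|Ω⟩⟨Ω|`. -/
lemma pauliTensor_sum_mul_apply (x y z w : Bits n) :
    ∑ m : Fin n → Fin 4, pauliTensor m x y * pauliTensor m z w =
      if x = w ∧ y = z then 2 ^ n else 0 := by
  simp only [pauliTensor, Matrix.of_apply, ← Finset.prod_mul_distrib]
  rw [← Fintype.prod_sum (fun i k => pauli k (x i) (y i) * pauli k (z i) (w i))]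
  simp only [pauli_sum_mul_apply, Finset.prod_ite_zero, Finset.prod_const, Finset.card_univ,
    Fintype.card_fin, funext_iff, Finset.mem_univ, true_imp_iff, forall_and]

end Pauli

/-! ### The cost as a function of the overlap with the maximally entangled vector -/

section Cost

variable {ι : Type} [Fintype ι] [DecidableEq ι] {κ : Type} [Fintype κ]

/-- The overlap `⟨Ω, P Ω⟩` of `P` with the unnormalised maximally entangled vector
`Ω = ∑ᵢ eᵢ ⊗ eᵢ`. -/
def overlap {ι : Type} [Fintype ι] (P : Matrix (ι × ι) (ι × ι) ℂ) : ℂ := ∑ i, ∑ k, P (i, i) (k, k)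

/-- Each summand is `tr(P H²) = tr(H P H)` with `H` Hermitian. Nonnegativity bounds the infimum
below and makes the square root in the distance lossless. -/
lemma cost_nonneg {A : κ → Matrix ι ι ℂ} (hA : ∀ k, (A k).IsHermitian) (P : State (ι × ι)) :
    0 ≤ cost A P := by
  unfold cost costOperator
  rw [Finset.mul_sum, Matrix.trace_sum, Complex.re_sum]
  refine Finset.sum_nonneg fun k _ => ?_
  set H := A k ⊗ₖ (1 : Matrix ι ι ℂ)ᵀ - (1 : Matrix ι ι ℂ) ⊗ₖ (A k)ᵀ with hH
  have hHh : Hᴴ = H := by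
    rw [hH, Matrix.conjTranspose_sub, Matrix.conjTranspose_kronecker,
      Matrix.conjTranspose_kronecker, (hA k).eq, (hA k).transpose.eq]
    simp
  rw [pow_two, ← mul_assoc, Matrix.trace_mul_comm, ← mul_assoc]
  have h := (P.2.1.mul_mul_conjTranspose_same H).trace_nonneg
  rw [hHh] at h
  exact (Complex.le_def.1 h).1

lemma costOperator_pauliTensor {n : ℕ} (p q : Bits n × Bits n) :
    costOperator (pauliTensor (n := n)) p q =
      2 * 4 ^ n * (if p = q then 1 else 0) -
        2 * 2 ^ n * (if p.1 = p.2 ∧ q.1 = q.2 then 1 else 0) := by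
  have key : ∀ m : Fin n → Fin 4,
      (pauliTensor m ⊗ₖ (1 : Matrix (Bits n) (Bits n) ℂ)ᵀ - 1 ⊗ₖ (pauliTensor m)ᵀ) ^ 2 =
        (2 : ℂ) • (1 : Matrix (Bits n × Bits n) (Bits n × Bits n) ℂ)
          - (2 : ℂ) • (pauliTensor m ⊗ₖ (pauliTensor m)ᵀ) := by
    intro m
    rw [pow_two, sub_mul, mul_sub, mul_sub]
    simp only [← Matrix.mul_kronecker_mul, Matrix.transpose_one, one_mul, mul_one,
      ← Matrix.transpose_mul, pauliTensor_mul_self, Matrix.one_kronecker_one]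
    module
  have h1 : costOperator (pauliTensor (n := n)) p q = ∑ m : Fin n → Fin 4,
      (2 * (if p = q then 1 else 0) - 2 * (pauliTensor m p.1 q.1 * pauliTensor m q.2 p.2)) := by
    unfold costOperator
    rw [Matrix.sum_apply]
    refine Finset.sum_congr rfl fun m _ => ?_
    rw [key]
    simp [Matrix.one_apply]
  rw [h1, Finset.sum_sub_distrib, ← Finset.mul_sum, ← Finset.mul_sum, pauliTensor_sum_mul_apply,
    Finset.sum_const, Finset.card_univ, Fintype.card_fun, Fintype.card_fin, Fintype.card_fin,
    nsmul_eq_mul]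
  split_ifs <;> push_cast <;> ring

lemma cost_pauliTensor {n : ℕ} (P : State (Bits n × Bits n)) :
    cost (pauliTensor (n := n)) P = 2 * 4 ^ n - 2 * 2 ^ n * (overlap P.1).re := by
  have h : (P.1 * costOperator (pauliTensor (n := n))).trace =
      ((2 * 4 ^ n : ℝ) : ℂ) - ((2 * 2 ^ n : ℝ) : ℂ) * overlap P.1 := by
    simp only [Matrix.trace, Matrix.diag_apply, Matrix.mul_apply, costOperator_pauliTensor,
      mul_sub, Finset.sum_sub_distrib]
    congr 1
    · have ht := P.2.2
      simp only [Matrix.trace, Matrix.diag_apply] at ht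
      simp only [mul_ite, mul_one, mul_zero, Finset.sum_ite_eq', Finset.mem_univ, if_true,
        ← Finset.sum_mul, ht]
      push_cast; ring
    · unfold overlap
      simp only [Fintype.sum_prod_type, ite_and, mul_ite, mul_one, mul_zero, Finset.sum_ite_eq,
        Finset.mem_univ, if_true, Finset.mul_sum, Finset.sum_ite_irrel, Finset.sum_const_zero]
      push_cast
      refine Finset.sum_congr rfl fun i _ => Finset.sum_congr rfl fun k _ => ?_
      ring
  rw [cost, h, Complex.sub_re, Complex.re_ofReal_mul, Complex.ofReal_re]

end Cost

/-! ### Pure states and the uniqueness of their couplings -/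

section Couplings

variable {ι : Type} [Fintype ι]

/-- A pure state: a rank-one projection `v v*`. -/
def IsPure (ρ : State ι) : Prop := ∃ v : ι → ℂ, ρ.1 = Matrix.vecMulVec v (star v)

/-- The `2 × 2` minors of a rank-one matrix vanish. -/
lemma IsPure.mul_apply {ρ : State ι} (h : IsPure ρ) (i j k l : ι) :
    ρ.1 i j * ρ.1 k l = ρ.1 i l * ρ.1 k j := by
  obtain ⟨v, hv⟩ := h
  simp only [hv, Matrix.vecMulVec_apply]
  ring

lemma State.sum_diag (ρ : State ι) : ∑ i, ρ.1 i i = 1 := ρ.2.2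

lemma State.star_apply (ρ : State ι) (i j : ι) : star (ρ.1 i j) = ρ.1 j i :=
  ρ.2.1.isHermitian.apply j i

lemma IsPure.mul_self {ρ : State ι} (h : IsPure ρ) : ρ.1 * ρ.1 = ρ.1 := by
  ext i j
  rw [Matrix.mul_apply]
  simp only [h.mul_apply i _ _ j]
  rw [← Finset.mul_sum, ρ.sum_diag, mul_one]

/-- The product coupling `ω ⊗ ρᵀ`. -/
def productCoupling (ρ ω : State ι) : State (ι × ι) :=
  ⟨ω.1 ⊗ₖ ρ.1ᵀ, ω.2.1.kronecker ρ.2.1.transpose, by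
    rw [Matrix.trace_kronecker, Matrix.trace_transpose, ω.2.2, ρ.2.2, mul_one]⟩

lemma productCoupling_mem (ρ ω : State ι) : productCoupling ρ ω ∈ couplings ρ ω := by
  constructor
  · ext i j
    simp [productCoupling, partialTraceSnd, ← Finset.mul_sum, ρ.sum_diag]
  · ext i j
    simp [productCoupling, partialTraceFst, ← Finset.sum_mul, ω.sum_diag]

lemma overlap_productCoupling (ρ ω : State ι) :
    overlap (productCoupling ρ ω).1 = (ρ.1 * ω.1).trace := by
  rw [Matrix.trace_mul_comm]
  simp [overlap, productCoupling, Matrix.trace, Matrix.mul_apply]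

lemma posSemidef_spectral {κ : Type} [Fintype κ] [DecidableEq κ] {P : Matrix κ κ ℂ}
    (hP : P.PosSemidef) : ∃ U ∈ Matrix.unitaryGroup κ ℂ, ∃ d : κ → ℝ, (∀ i, 0 ≤ d i) ∧
      P = U * Matrix.diagonal (fun i => (d i : ℂ)) * Uᴴ :=
  ⟨hP.isHermitian.eigenvectorUnitary, hP.isHermitian.eigenvectorUnitary.2,
    hP.isHermitian.eigenvalues, hP.eigenvalues_nonneg, hP.isHermitian.spectral_theorem⟩

lemma unitary_diagonal_mul {κ : Type} [Fintype κ] [DecidableEq κ] {U : Matrix κ κ ℂ}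
    (hU : U ∈ Matrix.unitaryGroup κ ℂ) (a b : κ → ℂ) :
    U * Matrix.diagonal a * Uᴴ * (U * Matrix.diagonal b * Uᴴ) =
      U * Matrix.diagonal (fun i => a i * b i) * Uᴴ := by
  have h : Uᴴ * U = 1 := Matrix.mem_unitaryGroup_iff'.1 hU
  rw [← Matrix.diagonal_mul_diagonal]
  simp only [Matrix.mul_assoc]
  rw [← Matrix.mul_assoc Uᴴ U, h, Matrix.one_mul]

lemma unitary_diagonal_conjTranspose {κ : Type} [Fintype κ] [DecidableEq κ] (U : Matrix κ κ ℂ)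
    (d : κ → ℝ) : (U * Matrix.diagonal (fun i => (d i : ℂ)) * Uᴴ)ᴴ =
      U * Matrix.diagonal (fun i => (d i : ℂ)) * Uᴴ := by
  have : star (fun i => (d i : ℂ)) = fun i => (d i : ℂ) := by ext; simp
  rw [Matrix.conjTranspose_mul, Matrix.conjTranspose_mul, Matrix.diagonal_conjTranspose, this,
    Matrix.conjTranspose_conjTranspose, Matrix.mul_assoc]

/-- A positive semidefinite matrix has a Hermitian square root. -/
lemma posSemidef_exists_sqrt {κ : Type} [Fintype κ] [DecidableEq κ] {P : Matrix κ κ ℂ}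
    (hP : P.PosSemidef) : ∃ B : Matrix κ κ ℂ, Bᴴ = B ∧ P = B * B := by
  obtain ⟨U, hU, d, hd, h⟩ := posSemidef_spectral hP
  refine ⟨U * Matrix.diagonal (fun i => (√(d i) : ℂ)) * Uᴴ,
    unitary_diagonal_conjTranspose U _, ?_⟩
  rw [unitary_diagonal_mul hU, h]
  congr 3
  ext i
  rw [← Complex.ofReal_mul, Real.mul_self_sqrt (hd i)]

/-- With `P = B²`, the trace is the squared Hilbert–Schmidt norm of `BQ`. -/
lemma posSemidef_mul_eq_zero_of_trace {κ : Type} [Fintype κ] [DecidableEq κ]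
    {P Q : Matrix κ κ ℂ} (hP : P.PosSemidef) (hQ : Qᴴ = Q) (hQ2 : Q * Q = Q)
    (h : (P * Q).trace = 0) : P * Q = 0 := by
  obtain ⟨B, hB, rfl⟩ := posSemidef_exists_sqrt hP
  have h1 : ((B * Q)ᴴ * (B * Q)).trace = 0 := by
    rw [Matrix.conjTranspose_mul, hQ, hB, Matrix.mul_assoc, Matrix.trace_mul_comm, Matrix.mul_assoc,
      Matrix.mul_assoc, hQ2, ← Matrix.mul_assoc B]
    exact h
  have h2 := Matrix.trace_conjTranspose_mul_self_eq_zero_iff.1 h1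
  rw [Matrix.mul_assoc, h2, Matrix.mul_zero]

/-- A pure state has only the product coupling with any other state. -/
lemma eq_productCoupling_of_isPure [DecidableEq ι] {ρ ω : State ι} (hρ : IsPure ρ) {P : State (ι × ι)}
    (hP : P ∈ couplings ρ ω) : P.1 = (productCoupling ρ ω).1 := by
  obtain ⟨h1, h2⟩ := hP
  set p : Matrix (ι × ι) (ι × ι) ℂ := (1 : Matrix ι ι ℂ) ⊗ₖ ρ.1ᵀ with hp
  have hmul : ∀ q i j, (P.1 * p) q (i, j) = ∑ l, P.1 q (i, l) * ρ.1 j l := by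
    intro q i j
    simp [hp, Matrix.mul_apply, Fintype.sum_prod_type, Matrix.one_apply, Finset.sum_ite_irrel]
  have hpp : p * p = p := by
    rw [hp, ← Matrix.mul_kronecker_mul, one_mul, ← Matrix.transpose_mul, hρ.mul_self]
  have hph : pᴴ = p := by
    rw [hp, Matrix.conjTranspose_kronecker, Matrix.conjTranspose_one,
      ρ.2.1.isHermitian.transpose.eq]
  -- The marginal `ρᵀ` gives `tr(P p) = tr(ρᵀ ρᵀ) = 1 = tr P`, so `P` lives on the range of the
  -- projection `p = I ⊗ ρᵀ`, where the second factor is one-dimensional.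
  have htr : (P.1 * (1 - p)).trace = 0 := by
    rw [mul_sub, mul_one, Matrix.trace_sub, sub_eq_zero]
    refine P.2.2.trans ?_
    have h3 : (partialTraceFst P.1 * ρ.1ᵀ).trace = 1 := by
      rw [h2, ← Matrix.transpose_mul, hρ.mul_self, Matrix.trace_transpose, ρ.2.2]
    refine h3.symm.trans ?_
    simp only [Matrix.trace, Matrix.diag_apply, Fintype.sum_prod_type, hmul]
    simp only [Matrix.mul_apply, partialTraceFst, Matrix.of_apply, Finset.sum_mul,
      Matrix.transpose_apply]
    conv_rhs => rw [Finset.sum_comm]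
    exact Finset.sum_congr rfl fun j _ => Finset.sum_comm
  have h0 := posSemidef_mul_eq_zero_of_trace P.2.1 (Q := 1 - p)
    (by rw [Matrix.conjTranspose_sub, hph, Matrix.conjTranspose_one])
    (by rw [sub_mul, mul_sub, mul_sub, hpp]; simp) htr
  have h4 : P.1 * p = P.1 := by rw [mul_sub, mul_one, sub_eq_zero] at h0; exact h0.symm
  have h5 : p * P.1 = P.1 := by
    have := congrArg Matrix.conjTranspose h4
    rwa [Matrix.conjTranspose_mul, hph, P.2.1.isHermitian.eq] at this
  have h4' : ∀ i j i' j', P.1 (i, j) (i', j') = ∑ l, P.1 (i, j) (i', l) * ρ.1 j' l := by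
    intro i j i' j'
    rw [← hmul, h4]
  have h5' : ∀ i j i' j', P.1 (i, j) (i', j') = ∑ k, ρ.1 k j * P.1 (i, k) (i', j') := by
    intro i j i' j'
    conv_lhs => rw [← h5]
    simp [hp, Matrix.mul_apply, Fintype.sum_prod_type, Matrix.one_apply, Finset.sum_ite_irrel]
  ext ⟨i, j⟩ ⟨i', j'⟩
  have h6 : ω.1 i i' = ∑ k, P.1 (i, k) (i', k) := by rw [← h1]; rfl
  simp only [productCoupling, Matrix.kroneckerMap_apply, Matrix.transpose_apply]
  rw [h6, h5', Finset.sum_mul]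
  refine Finset.sum_congr rfl fun k _ => ?_
  rw [h4' i k i' j', h4' i k i' k, Finset.mul_sum, Finset.sum_mul]
  refine Finset.sum_congr rfl fun l _ => ?_
  linear_combination P.1 (i, k) (i', l) * hρ.mul_apply k j j' l

end Couplings

end QubitWasserstein

namespace QubitWasserstein

/-! ### Detecting purity through self-couplings -/

section Purification

variable {ι : Type} [Fintype ι]

lemma vecMulVec_posSemidef {κ : Type} [Fintype κ] (v : κ → ℂ) :
    (Matrix.vecMulVec v (star v)).PosSemidef := Matrix.posSemidef_vecMulVec_self_star v

/-- A Hermitian square root `S` of `ρ` gives the self-coupling `|S⟩⟩⟨⟨S|` of `ρ`. -/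
lemma exists_coupling_of_sqrt (ρ : State ι) {S : Matrix ι ι ℂ} (hS : Sᴴ = S)
    (h : ρ.1 = S * S) : ∃ P ∈ couplings ρ ρ, overlap P.1 = S.trace * star S.trace := by
  have hSa : ∀ i j, star (S i j) = S j i := fun i j => by
    conv_rhs => rw [← hS]
    rfl
  let v : ι × ι → ℂ := fun p => S p.1 p.2
  have htr : (Matrix.vecMulVec v (star v)).trace = 1 := by
    rw [← ρ.2.2, h]
    simp [Matrix.trace, Matrix.vecMulVec_apply, v, Fintype.sum_prod_type, Matrix.mul_apply,
      hSa]
  refine ⟨⟨_, vecMulVec_posSemidef v, htr⟩, ⟨?_, ?_⟩, ?_⟩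
  · ext i j
    rw [h]
    simp only [partialTraceSnd, Matrix.of_apply, Matrix.vecMulVec_apply, v, Pi.star_apply, hSa,
      Matrix.mul_apply]
  · ext i j
    rw [h]
    simp only [partialTraceFst, Matrix.of_apply, Matrix.vecMulVec_apply, v, Pi.star_apply, hSa,
      Matrix.mul_apply, Matrix.transpose_apply]
    exact Finset.sum_congr rfl fun k _ => mul_comm _ _
  · simp only [overlap, Matrix.vecMulVec_apply, v, Pi.star_apply, Matrix.trace,
      Matrix.diag_apply, star_sum, Finset.sum_mul_sum]

/-- If every self-coupling of `ρ` has overlap at most `1`, then `ρ` is pure. -/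
lemma isPure_of_overlap_le [DecidableEq ι] (ρ : State ι)
    (h : ∀ P ∈ couplings ρ ρ, (overlap P.1).re ≤ 1) : IsPure ρ := by
  obtain ⟨U, hU, d, hd, hρ⟩ := posSemidef_spectral ρ.2.1
  have hUU : Uᴴ * U = 1 := Matrix.mem_unitaryGroup_iff'.1 hU
  have htr : ∀ a : ι → ℂ, (U * Matrix.diagonal a * Uᴴ).trace = ∑ i, a i := by
    intro a
    rw [Matrix.trace_mul_comm, ← Matrix.mul_assoc, hUU, Matrix.one_mul, Matrix.trace_diagonal]
  have hsum : ∑ i, d i = 1 := by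
    have := ρ.2.2
    rw [hρ, htr] at this
    exact_mod_cast this
  obtain ⟨P, hP, hov⟩ := exists_coupling_of_sqrt ρ
    (unitary_diagonal_conjTranspose U fun i => √(d i)) (by
      rw [unitary_diagonal_mul hU, hρ]
      congr 3
      ext i
      rw [← Complex.ofReal_mul, Real.mul_self_sqrt (hd i)])
  have h1 := h P hP
  rw [hov, htr, ← Complex.ofReal_sum] at h1
  have h2 : (∑ i, √(d i)) * (∑ i, √(d i)) ≤ 1 := by
    simpa using h1
  have h3 : ∑ i, √(d i) ≤ 1 := by
    by_contra! hc
    nlinarith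
  have hle1 : ∀ i, d i ≤ 1 := fun i => by
    rw [← hsum]
    exact Finset.single_le_sum (fun j _ => hd j) (Finset.mem_univ i)
  -- The eigenvalues satisfy `d ≤ √d` and `∑ √d ≤ 1 = ∑ d`, so equality holds termwise and every
  -- eigenvalue is `0` or `1`.
  have hle : ∀ i, d i ≤ √(d i) := fun i =>
    Real.le_sqrt_of_sq_le (by nlinarith [hd i, hle1 i])
  have heq : ∀ i, d i = √(d i) := by
    have := (Finset.sum_eq_sum_iff_of_le fun i (_ : i ∈ Finset.univ) => hle i).1
      (le_antisymm (Finset.sum_le_sum fun i _ => hle i) (by rw [hsum]; exact h3))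
    exact fun i => this i (Finset.mem_univ i)
  have h01 : ∀ i, d i = 0 ∨ d i = 1 := fun i => by
    have h4 := Real.mul_self_sqrt (hd i)
    rw [← heq i] at h4
    have : d i * (d i - 1) = 0 := by linarith
    rcases mul_eq_zero.1 this with h | h
    · exact Or.inl h
    · exact Or.inr (by linarith)
  obtain ⟨k, hk⟩ : ∃ k, d k ≠ 0 := by
    by_contra! hc
    simp [hc] at hsum
  have hk1 : d k = 1 := (h01 k).resolve_left hk
  have hne : ∀ i, i ≠ k → d i = 0 := fun i hi => by
    refine (h01 i).resolve_right fun hi1 => ?_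
    have : d i + d k ≤ ∑ j, d j := by
      rw [← Finset.sum_pair hi]
      exact Finset.sum_le_sum_of_subset_of_nonneg (Finset.subset_univ _) fun j _ _ => hd j
    linarith
  refine ⟨fun i => U i k, ?_⟩
  rw [hρ]
  ext i j
  rw [Matrix.mul_apply, Finset.sum_eq_single k]
  · simp [Matrix.mul_diagonal, hk1, Matrix.vecMulVec_apply]
  · intro l _ hl
    simp [Matrix.mul_diagonal, hne l hl]
  · simp

lemma trace_mul_re_pure_self {ρ : State ι} (h : IsPure ρ) : (ρ.1 * ρ.1).trace.re = 1 := by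
  rw [h.mul_self, ρ.2.2, Complex.one_re]

lemma trace_mul_im (ρ ω : State ι) : (ρ.1 * ω.1).trace.im = 0 := by
  have h : star (ρ.1 * ω.1).trace = (ρ.1 * ω.1).trace := by
    rw [← Matrix.trace_conjTranspose, Matrix.conjTranspose_mul, ρ.2.1.isHermitian.eq,
      ω.2.1.isHermitian.eq, Matrix.trace_mul_comm]
  exact Complex.conj_eq_iff_im.1 h

end Purification

/-! ### Isometries preserve purity and overlaps -/

section SymDist

variable {n : ℕ}

lemma symDist_sq (ρ ω : State (Bits n)) :
    symDist n ρ ω ^ 2 = sInf (cost (pauliTensor (n := n)) '' couplings ρ ω) := by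
  refine Real.sq_sqrt (Real.sInf_nonneg ?_)
  rintro _ ⟨P, -, rfl⟩
  exact cost_nonneg pauliTensor_isHermitian P

lemma symDist_sq_le {ρ ω : State (Bits n)} {P : State (Bits n × Bits n)}
    (hP : P ∈ couplings ρ ω) :
    symDist n ρ ω ^ 2 ≤ 2 * 4 ^ n - 2 * 2 ^ n * (overlap P.1).re := by
  rw [symDist_sq, ← cost_pauliTensor]
  refine csInf_le ⟨0, ?_⟩ ⟨P, hP, rfl⟩
  rintro _ ⟨Q, -, rfl⟩
  exact cost_nonneg pauliTensor_isHermitian Q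

lemma symDist_sq_of_isPure {ρ : State (Bits n)} (hρ : IsPure ρ) (ω : State (Bits n)) :
    symDist n ρ ω ^ 2 = 2 * 4 ^ n - 2 * 2 ^ n * (ρ.1 * ω.1).trace.re := by
  have h : cost (pauliTensor (n := n)) '' couplings ρ ω =
      {2 * 4 ^ n - 2 * 2 ^ n * (ρ.1 * ω.1).trace.re} := by
    rw [Set.eq_singleton_iff_unique_mem]
    refine ⟨⟨_, productCoupling_mem ρ ω, ?_⟩, ?_⟩
    · rw [cost_pauliTensor, overlap_productCoupling]
    · rintro _ ⟨P, hP, rfl⟩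
      rw [cost_pauliTensor, eq_productCoupling_of_isPure hρ hP, overlap_productCoupling]
  rw [symDist_sq, h, csInf_singleton]

variable {Φ : State (Bits n) → State (Bits n)}

/-- The self-distance of a pure state is the one given by overlap `1`. Since `Φ ρ` has the same
self-distance, none of its self-couplings can have a larger overlap. -/
lemma isPure_map_of_isometry (h : ∀ ρ ω, symDist n (Φ ρ) (Φ ω) = symDist n ρ ω)
    {ρ : State (Bits n)} (hρ : IsPure ρ) : IsPure (Φ ρ) := by
  refine isPure_of_overlap_le _ fun P hP => ?_
  have h1 := symDist_sq_le hP
  rw [h, symDist_sq_of_isPure hρ, trace_mul_re_pure_self hρ] at h1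
  have h2 : (0 : ℝ) < 2 ^ n := by positivity
  nlinarith

lemma trace_map_mul_of_isometry (h : ∀ ρ ω, symDist n (Φ ρ) (Φ ω) = symDist n ρ ω)
    {ρ : State (Bits n)} (hρ : IsPure ρ) (ω : State (Bits n)) :
    ((Φ ρ).1 * (Φ ω).1).trace = (ρ.1 * ω.1).trace := by
  refine Complex.ext ?_ (by rw [trace_mul_im, trace_mul_im])
  have h1 := symDist_sq_of_isPure hρ ω
  rw [← h, symDist_sq_of_isPure (isPure_map_of_isometry h hρ)] at h1
  have h2 : (2 * 2 ^ n : ℝ) ≠ 0 := by positivity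
  exact mul_left_cancel₀ h2 (by linarith)

end SymDist

end QubitWasserstein

namespace QubitWasserstein

/-! ### Normalised pure states and what determines a state -/

section PureStates

variable {ι : Type} [Fintype ι]

/-- The squared Euclidean norm of a vector. -/
noncomputable def sqNorm (v : ι → ℂ) : ℝ := ∑ i, Complex.normSq (v i)

lemma sqNorm_pos {v : ι → ℂ} (hv : v ≠ 0) : 0 < sqNorm v := by
  obtain ⟨i, hi⟩ := Function.ne_iff.1 hv
  exact Finset.sum_pos' (fun j _ => Complex.normSq_nonneg _)
    ⟨i, Finset.mem_univ i, Complex.normSq_pos.2 hi⟩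

lemma star_dotProduct_self (v : ι → ℂ) : star v ⬝ᵥ v = (sqNorm v : ℂ) := by
  simp [dotProduct, sqNorm, Complex.normSq_eq_conj_mul_self]

/-- The pure state spanned by a nonzero vector. -/
noncomputable def pureState (v : ι → ℂ) (hv : v ≠ 0) : State ι :=
  ⟨((sqNorm v)⁻¹ : ℂ) • Matrix.vecMulVec v (star v), by
    refine (vecMulVec_posSemidef v).smul ?_
    rw [← Complex.ofReal_inv]
    exact_mod_cast (inv_pos.2 (sqNorm_pos hv)).le, by
    rw [Matrix.trace_smul, Matrix.trace_vecMulVec, dotProduct_comm, star_dotProduct_self,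
      smul_eq_mul, inv_mul_cancel₀]
    exact_mod_cast (sqNorm_pos hv).ne'⟩

lemma pureState_apply (v : ι → ℂ) (hv : v ≠ 0) (i j : ι) :
    (pureState v hv).1 i j = (sqNorm v : ℂ)⁻¹ * (v i * star (v j)) := rfl

lemma pureState_isPure (v : ι → ℂ) (hv : v ≠ 0) : IsPure (pureState v hv) := by
  refine ⟨((√(sqNorm v))⁻¹ : ℂ) • v, ?_⟩
  ext i j
  have h : ((√(sqNorm v))⁻¹ : ℂ) * ((√(sqNorm v))⁻¹ : ℂ) = (sqNorm v : ℂ)⁻¹ := by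
    rw [← mul_inv, ← Complex.ofReal_mul, Real.mul_self_sqrt (sqNorm_pos hv).le]
  rw [pureState_apply, ← h]
  simp [Matrix.vecMulVec_apply]
  ring

lemma trace_vecMulVec_mul (v : ι → ℂ) (X : Matrix ι ι ℂ) :
    (Matrix.vecMulVec v (star v) * X).trace = star v ⬝ᵥ X *ᵥ v := by
  rw [Matrix.vecMulVec_mul, Matrix.trace_vecMulVec, dotProduct_comm, Matrix.dotProduct_mulVec]

lemma trace_pureState_mul (v : ι → ℂ) (hv : v ≠ 0) (X : Matrix ι ι ℂ) :
    ((pureState v hv).1 * X).trace = (sqNorm v : ℂ)⁻¹ * (star v ⬝ᵥ X *ᵥ v) := by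
  rw [← trace_vecMulVec_mul]
  simp [pureState]

lemma IsPure.apply_eq_zero {ρ : State ι} (h : IsPure ρ) {i : ι} (hi : ρ.1 i i = 0) (j : ι) :
    ρ.1 j i = 0 := by
  have h1 : ρ.1 j i * star (ρ.1 j i) = 0 := by
    rw [ρ.star_apply, h.mul_apply, hi, mul_zero]
  simpa using h1

/-- A pure state is determined by a row with nonzero diagonal entry. -/
lemma IsPure.ext_row {ρ τ : State ι} (hρ : IsPure ρ) (hτ : IsPure τ) (o : ι)
    (ho : ρ.1 o o ≠ 0) (h : ∀ j, ρ.1 o j = τ.1 o j) : ρ = τ := by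
  apply Subtype.ext
  ext i j
  have h' : ρ.1 i o = τ.1 i o := by rw [← ρ.star_apply, h, τ.star_apply]
  have h1 := hρ.mul_apply i j o o
  have h2 := hτ.mul_apply i j o o
  refine mul_right_cancel₀ ho ?_
  rw [h1, h, h', h, h2]

/-- The overlap of two pure states is read off from row and column `o` alone; keeping the diagonal
factors on the left avoids division. -/
lemma IsPure.trace_mul {ρ τ : State ι} (hρ : IsPure ρ) (hτ : IsPure τ) (o : ι) :
    (ρ.1 * τ.1).trace * (ρ.1 o o * τ.1 o o) =
      (∑ k, ρ.1 k o * τ.1 o k) * ∑ k, ρ.1 o k * τ.1 k o := by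
  rw [Finset.sum_mul_sum]
  simp only [Matrix.trace, Matrix.diag_apply, Matrix.mul_apply, Finset.sum_mul]
  refine Finset.sum_congr rfl fun k _ => Finset.sum_congr rfl fun l _ => ?_
  have h1 := hρ.mul_apply k l o o
  have h2 := hτ.mul_apply l k o o
  linear_combination τ.1 l k * τ.1 o o * h1 + ρ.1 k o * ρ.1 o l * h2

/-- A matrix is determined by its overlaps with the pure states not orthogonal to `o`. -/
lemma ext_of_trace_pureState [DecidableEq ι] {X Y : Matrix ι ι ℂ} (o : ι)
    (h : ∀ ρ : State ι, IsPure ρ → ρ.1 o o ≠ 0 → (ρ.1 * X).trace = (ρ.1 * Y).trace) :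
    X = Y := by
  have key : ∀ v : ι → ℂ, v o ≠ 0 → star v ⬝ᵥ (X - Y) *ᵥ v = 0 := by
    intro v hvo
    have hv : v ≠ 0 := fun hv => hvo (by rw [hv]; rfl)
    have hN : (sqNorm v : ℂ)⁻¹ ≠ 0 :=
      inv_ne_zero (by exact_mod_cast (sqNorm_pos hv).ne')
    have h1 := h (pureState v hv) (pureState_isPure v hv) (by
      rw [pureState_apply]
      exact mul_ne_zero hN (mul_ne_zero hvo (star_ne_zero.2 hvo)))
    rw [trace_pureState_mul, trace_pureState_mul] at h1
    rw [Matrix.sub_mulVec, dotProduct_sub, mul_left_cancel₀ hN h1, sub_self]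
  have all : ∀ v : ι → ℂ, star v ⬝ᵥ (X - Y) *ᵥ v = 0 := by
    intro v
    by_cases hv : v o = 0
    · set e : ι → ℂ := Pi.single o 1 with he
      have heo : e o = 1 := by simp [he]
      have h1 := key (v + e) (by simp [hv, heo])
      have h2 := key (v - e) (by simp [hv, heo])
      have h3 := key e (by simp [heo])
      simp only [star_add, star_sub, Matrix.mulVec_add, Matrix.mulVec_sub, dotProduct_add,
        dotProduct_sub, add_dotProduct, sub_dotProduct] at h1 h2 h3
      linear_combination (h1 + h2) / 2 - h3
    · exact key v hv
  have h0 : Matrix.toEuclideanLin (X - Y) = 0 := by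
    rw [← inner_map_self_eq_zero]
    intro x
    rw [← inner_conj_symm, EuclideanSpace.inner_eq_star_dotProduct, dotProduct_comm]
    have h1 := congrArg star (all x.ofLp)
    simpa [Matrix.sub_mulVec, dotProduct_sub] using h1
  exact sub_eq_zero.1 ((LinearEquiv.map_eq_zero_iff _).1 h0)

end PureStates

/-! ### Reduction to maps that preserve diagonals -/

section Wigner

variable {ι : Type} [Fintype ι] [DecidableEq ι]

/-- Maps of states that preserve purity and the overlaps of pure states with all states. -/
structure PreservesOverlap (Φ : State ι → State ι) : Prop where
  isPure : ∀ {ρ}, IsPure ρ → IsPure (Φ ρ)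
  trace : ∀ {ρ}, IsPure ρ → ∀ ω, ((Φ ρ).1 * (Φ ω).1).trace = (ρ.1 * ω.1).trace

/-- The state `W ρ W*`. -/
def State.conj {W : Matrix ι ι ℂ} (hW : W ∈ Matrix.unitaryGroup ι ℂ) (ρ : State ι) : State ι :=
  ⟨W * ρ.1 * Wᴴ, ρ.2.1.mul_mul_conjTranspose_same W, by
    have h : Wᴴ * W = 1 := Matrix.mem_unitaryGroup_iff'.1 hW
    rw [Matrix.trace_mul_comm, ← Matrix.mul_assoc, h, Matrix.one_mul, ρ.2.2]⟩

lemma IsPure.conj {W : Matrix ι ι ℂ} (hW : W ∈ Matrix.unitaryGroup ι ℂ) {ρ : State ι}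
    (h : IsPure ρ) : IsPure (ρ.conj hW) := by
  obtain ⟨v, hv⟩ := h
  refine ⟨W *ᵥ v, ?_⟩
  simp only [State.conj, hv]
  rw [Matrix.mul_vecMulVec, Matrix.vecMulVec_mul, Matrix.star_mulVec]

lemma trace_conj_mul_conj {W : Matrix ι ι ℂ} (hW : W ∈ Matrix.unitaryGroup ι ℂ)
    (ρ ω : State ι) : ((ρ.conj hW).1 * (ω.conj hW).1).trace = (ρ.1 * ω.1).trace := by
  have h : Wᴴ * W = 1 := Matrix.mem_unitaryGroup_iff'.1 hW
  have h1 : W * ρ.1 * Wᴴ * (W * ω.1 * Wᴴ) = W * (ρ.1 * ω.1) * Wᴴ := by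
    simp only [Matrix.mul_assoc]
    rw [← Matrix.mul_assoc Wᴴ W, h, Matrix.one_mul]
  simp only [State.conj]
  rw [h1, Matrix.trace_mul_comm, ← Matrix.mul_assoc, h, Matrix.one_mul]

lemma PreservesOverlap.conj {W : Matrix ι ι ℂ} (hW : W ∈ Matrix.unitaryGroup ι ℂ)
    {Φ : State ι → State ι} (h : PreservesOverlap Φ) :
    PreservesOverlap fun ρ => (Φ ρ).conj hW where
  isPure hρ := (h.isPure hρ).conj hW
  trace hρ ω := by rw [trace_conj_mul_conj, h.trace hρ]

omit [DecidableEq ι] in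
lemma star_mulVec_apply (W X : Matrix ι ι ℂ) (i j : ι) :
    (Wᴴ * X * W) i j = star (fun k => W k i) ⬝ᵥ X *ᵥ (fun k => W k j) := by
  rw [Matrix.mul_assoc, Matrix.mul_apply]
  rfl

/-- After a unitary change of basis an overlap-preserving map preserves all diagonals. -/
lemma PreservesOverlap.exists_unitary_diag {Φ : State ι → State ι} (h : PreservesOverlap Φ) :
    ∃ W ∈ Matrix.unitaryGroup ι ℂ, ∀ ω i, (Wᴴ * (Φ ω).1 * W) i i = ω.1 i i := by
  have hne : ∀ i, (Pi.single i 1 : ι → ℂ) ≠ 0 := fun i => by simp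
  let E : ι → State ι := fun i => pureState (Pi.single i 1) (hne i)
  have hE : ∀ i (ω : State ι), ((E i).1 * ω.1).trace = ω.1 i i := by
    intro i ω
    have : sqNorm (Pi.single i 1 : ι → ℂ) = 1 := by
      have := star_dotProduct_self (Pi.single i 1 : ι → ℂ)
      simp at this
      exact_mod_cast this.symm
    rw [trace_pureState_mul, this]
    simp
  choose f hf using fun i => h.isPure (pureState_isPure _ (hne i))
  have hdiag : ∀ ω i, star (f i) ⬝ᵥ (Φ ω).1 *ᵥ f i = ω.1 i i := by
    intro ω i
    rw [← trace_vecMulVec_mul, ← hf i, h.trace (pureState_isPure _ (hne i)) ω, ← hE i ω]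
  refine ⟨Matrix.of fun k i => f i k, ?_, fun ω i => ?_⟩
  · rw [Matrix.mem_unitaryGroup_iff']
    ext i j
    have h1 : (star (Matrix.of fun k i => f i k) * Matrix.of fun k i => f i k) i j =
        star (f i) ⬝ᵥ f j := rfl
    rw [h1, Matrix.one_apply]
    split_ifs with hij
    · subst hij
      have h2 := (Φ (pureState _ (hne i))).2.2
      rw [hf i, Matrix.trace_vecMulVec, dotProduct_comm] at h2
      exact h2
    -- For `i ≠ j` the preserved overlap is `|⟨f i, f j⟩|² = 0`.
    · have h2 := hdiag (E j) i
      have h3 : (Φ (E j)).1 = Matrix.vecMulVec (f j) (star (f j)) := hf j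
      have h4 : (E j).1 i i = 0 := by
        simp [E, pureState_apply, hij]
      rw [h3, h4, Matrix.vecMulVec_mulVec, dotProduct_smul] at h2
      have h5 : star (f j) ⬝ᵥ f i = star (star (f i) ⬝ᵥ f j) := by
        rw [Matrix.star_dotProduct]
      rw [h5] at h2
      simpa using h2
  · rw [star_mulVec_apply]
    exact hdiag ω i

end Wigner

end QubitWasserstein

namespace QubitWasserstein

/-! ### Phases and conjugations in a fixed row -/

section DiagonalPreserving

variable {ι : Type} [Fintype ι] [DecidableEq ι]

/-- The vector `e_o + z e_j`. -/
def twoLevelVec (o j : ι) (z : ℂ) : ι → ℂ := fun k => if k = o then 1 else if k = j then z else 0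

omit [Fintype ι] in
lemma twoLevelVec_ne_zero (o j : ι) (z : ℂ) : twoLevelVec o j z ≠ 0 := fun h => by
  have := congrFun h o
  simp [twoLevelVec] at this

/-- The pure state spanned by `e_o + z e_j`. -/
noncomputable def twoLevel (o j : ι) (z : ℂ) : State ι :=
  pureState (twoLevelVec o j z) (twoLevelVec_ne_zero o j z)

lemma twoLevel_isPure (o j : ι) (z : ℂ) : IsPure (twoLevel o j z) := pureState_isPure _ _

lemma sum_eq_pair {M : Type} [AddCommMonoid M] {o j : ι} (hj : j ≠ o) (f : ι → M)
    (hf : ∀ k, k ≠ o → k ≠ j → f k = 0) : ∑ k, f k = f o + f j := by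
  rw [← Finset.sum_pair hj.symm]
  refine (Finset.sum_subset (Finset.subset_univ _) fun k _ hk => ?_).symm
  simp only [Finset.mem_insert, Finset.mem_singleton, not_or] at hk
  exact hf k hk.1 hk.2

lemma sqNorm_twoLevelVec {o j : ι} (hj : j ≠ o) {z : ℂ} (hz : Complex.normSq z = 1) :
    sqNorm (twoLevelVec o j z) = 2 := by
  rw [sqNorm, sum_eq_pair hj _ fun k h1 h2 => by simp [twoLevelVec, h1, h2]]
  simp [twoLevelVec, hj, hz]
  norm_num

lemma twoLevel_apply {o j : ι} (hj : j ≠ o) {z : ℂ} (hz : Complex.normSq z = 1) (k l : ι) :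
    (twoLevel o j z).1 k l = 2⁻¹ * (twoLevelVec o j z k * star (twoLevelVec o j z l)) := by
  rw [twoLevel, pureState_apply, sqNorm_twoLevelVec hj hz]
  simp

lemma trace_twoLevel_mul {o j : ι} (hj : j ≠ o) {z : ℂ} (hz : Complex.normSq z = 1)
    (ω : State ι) : ((twoLevel o j z).1 * ω.1).trace =
      2⁻¹ * (ω.1 o o + ω.1 j j + 2 * ((z * ω.1 o j).re : ℂ)) := by
  rw [twoLevel, trace_pureState_mul, sqNorm_twoLevelVec hj hz]
  have h1 : ((z * ω.1 o j).re : ℂ) = (z * ω.1 o j + star z * ω.1 j o) / 2 := by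
    rw [Complex.re_eq_add_conj, ← ω.star_apply o j]
    simp
  have hz' : star z * z = 1 := by
    have := Complex.normSq_eq_conj_mul_self (z := z)
    rw [hz] at this
    exact_mod_cast this.symm
  rw [h1, dotProduct, sum_eq_pair hj _ fun k h1 h2 => by simp [twoLevelVec, h1, h2]]
  simp only [Matrix.mulVec, dotProduct]
  rw [sum_eq_pair hj _ fun k h1 h2 => by simp [twoLevelVec, h1, h2],
    sum_eq_pair hj _ fun k h1 h2 => by simp [twoLevelVec, h1, h2]]
  simp only [twoLevelVec, Pi.star_apply, if_true, hj, if_false, star_one]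
  push_cast
  linear_combination 2⁻¹ * ω.1 j j * hz'

variable {Φ : State ι → State ι}

/-- The image is pure with diagonal `1/2` at `o` and `j` and `0` elsewhere, which leaves only a
relative phase free. -/
lemma PreservesOverlap.map_twoLevel (h : PreservesOverlap Φ)
    (hd : ∀ ω i, (Φ ω).1 i i = ω.1 i i) {o j : ι} (hj : j ≠ o) {z : ℂ}
    (hz : Complex.normSq z = 1) :
    ∃ w, Complex.normSq w = 1 ∧ Φ (twoLevel o j z) = twoLevel o j w := by
  set τ := Φ (twoLevel o j z) with hτ
  have hp : IsPure τ := h.isPure (twoLevel_isPure o j z)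
  have hdo : τ.1 o o = 2⁻¹ := by
    rw [hd, twoLevel_apply hj hz]
    simp [twoLevelVec]
  have hdj : τ.1 j j = 2⁻¹ := by
    rw [hd, twoLevel_apply hj hz]
    simp [twoLevelVec, hj, Complex.mul_conj, hz]
  have hdk : ∀ k, k ≠ o → k ≠ j → τ.1 k k = 0 := fun k h1 h2 => by
    rw [hd, twoLevel_apply hj hz]
    simp [twoLevelVec, h1, h2]
  have hw : Complex.normSq (2 * τ.1 j o) = 1 := by
    have h1 := hp.mul_apply j o o j
    rw [hdo, hdj, ← τ.star_apply j o] at h1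
    have h2 : ((Complex.normSq (2 * τ.1 j o) : ℝ) : ℂ) = 1 := by
      rw [← Complex.mul_conj, map_mul, Complex.conj_ofNat]
      have h3 : (starRingEnd ℂ) (τ.1 j o) = star (τ.1 j o) := rfl
      rw [h3]
      linear_combination 4 * h1
    exact_mod_cast h2
  -- The `(j, o)` entry of `twoLevel o j w` is `w / 2`.
  refine ⟨2 * τ.1 j o, hw, hp.ext_row (twoLevel_isPure _ _ _) o (by rw [hdo]; norm_num) ?_⟩
  intro k
  rw [twoLevel_apply hj hw]
  by_cases hko : k = o
  · subst hko
    simp [twoLevelVec, hdo]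
  by_cases hkj : k = j
  · subst hkj
    rw [← τ.star_apply k o]
    simp [twoLevelVec, hko]
  · rw [hp.apply_eq_zero (hdk k hko hkj)]
    simp [twoLevelVec, hko, hkj]

/-- The overlap with `twoLevel o j z` is a combination of two diagonal entries, which are preserved,
and `Re (z ω_oj)`. -/
lemma PreservesOverlap.exists_re_mul (h : PreservesOverlap Φ)
    (hd : ∀ ω i, (Φ ω).1 i i = ω.1 i i) {o j : ι} (hj : j ≠ o) {z : ℂ}
    (hz : Complex.normSq z = 1) :
    ∃ w, Complex.normSq w = 1 ∧ Φ (twoLevel o j z) = twoLevel o j w ∧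
      ∀ ω, (w * (Φ ω).1 o j).re = (z * ω.1 o j).re := by
  obtain ⟨w, hw, hΦ⟩ := h.map_twoLevel hd hj hz
  refine ⟨w, hw, hΦ, fun ω => ?_⟩
  have h1 := h.trace (twoLevel_isPure o j z) ω
  rw [hΦ, trace_twoLevel_mul hj hw, trace_twoLevel_mul hj hz, hd, hd] at h1
  have h2 : (((w * (Φ ω).1 o j).re : ℝ) : ℂ) = (z * ω.1 o j).re := by
    linear_combination h1
  exact_mod_cast h2

/-- Up to a phase, each entry of row `o` is either preserved or conjugated. -/
lemma PreservesOverlap.exists_phase (h : PreservesOverlap Φ)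
    (hd : ∀ ω i, (Φ ω).1 i i = ω.1 i i) {o j : ι} (hj : j ≠ o) :
    ∃ c : ℂ, Complex.normSq c = 1 ∧ ((∀ ω, c * (Φ ω).1 o j = ω.1 o j) ∨
      ∀ ω, c * (Φ ω).1 o j = ω.1 j o) := by
  have hI : Complex.normSq Complex.I = 1 := by simp
  obtain ⟨c, hc, -, hre⟩ := h.exists_re_mul hd hj (z := 1) (by simp)
  obtain ⟨w, hw, hT, him⟩ := h.exists_re_mul hd hj hI
  -- Evaluating the `z = 1` relation at the `z = I` test state gives `Re (c w̄) = 0`: the unit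
  -- numbers `w` and `c` are orthogonal in the real plane, so `w = ±I c`. The plus sign preserves
  -- the imaginary part of the entry, the minus sign reverses it.
  have h1 := hre (twoLevel o j Complex.I)
  rw [hT, twoLevel_apply hj hw, twoLevel_apply hj hI] at h1
  simp [twoLevelVec, hj] at h1
  have hc' := hc
  rw [Complex.normSq_apply] at hc hw
  have hIw : w = Complex.I * c ∨ w = -(Complex.I * c) := by
    have h2 : c.re * w.re + c.im * w.im = 0 := by linarith
    -- `t` is the real inner product of `w` with `I c`, so `w = t I c`.
    obtain ⟨t, ht⟩ : ∃ t, t = c.re * w.im - c.im * w.re := ⟨_, rfl⟩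
    have hr : w.re = -(t * c.im) := by
      rw [ht]
      linear_combination c.re * h2 - w.re * hc
    have him : w.im = t * c.re := by
      rw [ht]
      linear_combination c.im * h2 - w.im * hc
    have ht2 : (t - 1) * (t + 1) = 0 := by
      rw [hr, him] at hw
      linear_combination hw - t ^ 2 * hc
    rcases mul_eq_zero.1 ht2 with h3 | h3
    · left
      have h4 : t = 1 := by linarith
      apply Complex.ext <;> simp [hr, him, h4]
    · right
      have h4 : t = -1 := by linarith
      apply Complex.ext <;> simp [hr, him, h4]
  refine ⟨c, hc', ?_⟩
  rcases hIw with rfl | rfl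
  · left
    intro ω
    have h2 := hre ω
    have h3 := him ω
    rw [mul_assoc, Complex.I_mul_re, Complex.I_mul_re] at h3
    refine Complex.ext (by simpa using h2) (by linarith)
  · right
    intro ω
    have h2 := hre ω
    have h3 := him ω
    rw [neg_mul, mul_assoc, Complex.neg_re, Complex.I_mul_re, Complex.I_mul_re] at h3
    rw [← ω.star_apply o j]
    refine Complex.ext (by simpa using h2) ?_
    simp only [Complex.star_def, Complex.conj_im]
    linarith

/-- The vector `e_o + z e_i + z e_j`. -/
def threeLevelVec (o i j : ι) (z : ℂ) : ι → ℂ :=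
  fun k => if k = o then 1 else if k = i then z else if k = j then z else 0

omit [Fintype ι] in
lemma threeLevelVec_ne_zero (o i j : ι) (z : ℂ) : threeLevelVec o i j z ≠ 0 := fun h => by
  have := congrFun h o
  simp [threeLevelVec] at this

/-- The pure state spanned by `e_o + z e_i + z e_j`. -/
noncomputable def threeLevel (o i j : ι) (z : ℂ) : State ι :=
  pureState (threeLevelVec o i j z) (threeLevelVec_ne_zero o i j z)

lemma sum_eq_triple {M : Type} [AddCommMonoid M] {o i j : ι} (hi : i ≠ o) (hj : j ≠ o)
    (hij : i ≠ j) (f : ι → M) (hf : ∀ k, k ≠ o → k ≠ i → k ≠ j → f k = 0) :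
    ∑ k, f k = f o + f i + f j := by
  have h1 : ∑ k ∈ {o, i, j}, f k = f o + f i + f j := by
    rw [Finset.sum_insert (by simp [hi.symm, hj.symm]), Finset.sum_pair hij, add_assoc]
  rw [← h1]
  refine (Finset.sum_subset (Finset.subset_univ _) fun k _ hk => ?_).symm
  simp only [Finset.mem_insert, Finset.mem_singleton, not_or] at hk
  exact hf k hk.1 hk.2.1 hk.2.2

lemma threeLevel_apply {o i j : ι} (hi : i ≠ o) (hj : j ≠ o) (hij : i ≠ j) {z : ℂ}
    (hz : Complex.normSq z = 1) (k l : ι) : (threeLevel o i j z).1 k l =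
      3⁻¹ * (threeLevelVec o i j z k * star (threeLevelVec o i j z l)) := by
  have h1 : sqNorm (threeLevelVec o i j z) = 3 := by
    rw [sqNorm, sum_eq_triple hi hj hij _ fun k h1 h2 h3 => by
      simp [threeLevelVec, h1, h2, h3]]
    simp [threeLevelVec, hi, hj, hz]
    norm_num
  rw [threeLevel, pureState_apply, h1]
  simp

/-- The entries of row `o` are preserved simultaneously or conjugated simultaneously. -/
lemma PreservesOverlap.phase_consistent (h : PreservesOverlap Φ)
    (hd : ∀ ω i, (Φ ω).1 i i = ω.1 i i) {o i j : ι} (hi : i ≠ o) (hj : j ≠ o) (hij : i ≠ j)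
    {a b : ℂ} (ha : Complex.normSq a = 1) (hb : Complex.normSq b = 1)
    (hA : ∀ ω, a * (Φ ω).1 o i = ω.1 o i) (hB : ∀ ω, b * (Φ ω).1 o j = ω.1 j o) : False := by
  have hI : Complex.normSq Complex.I = 1 := by simp
  have h1 : Complex.normSq 1 = 1 := by simp
  set u := threeLevel o i j 1 with hu
  set v := threeLevel o i j Complex.I with hv
  have pu : IsPure u := pureState_isPure _ _
  have pv : IsPure v := pureState_isPure _ _
  have ha' : star a * a = 1 := by
    have := Complex.normSq_eq_conj_mul_self (z := a)
    rw [ha] at this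
    exact_mod_cast this.symm
  have hb' : star b * b = 1 := by
    have := Complex.normSq_eq_conj_mul_self (z := b)
    rw [hb] at this
    exact_mod_cast this.symm
  have eA : ∀ ω, (Φ ω).1 o i = star a * ω.1 o i := fun ω => by
    rw [← hA ω, ← mul_assoc, ha', one_mul]
  have eB : ∀ ω, (Φ ω).1 o j = star b * ω.1 j o := fun ω => by
    rw [← hB ω, ← mul_assoc, hb', one_mul]
  have eA' : ∀ ω, (Φ ω).1 i o = a * ω.1 i o := fun ω => by
    rw [← State.star_apply, eA, star_mul', star_star, State.star_apply]
  have eB' : ∀ ω, (Φ ω).1 j o = b * ω.1 o j := fun ω => by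
    rw [← State.star_apply, eB, star_mul', star_star, State.star_apply]
  have hk : ∀ k, k ≠ o → k ≠ i → k ≠ j → (Φ u).1 o k = 0 := fun k h2 h3 h4 => by
    refine (h.isPure pu).apply_eq_zero ?_ o
    rw [hd, hu, threeLevel_apply hi hj hij h1]
    simp [threeLevelVec, h2, h3, h4]
  have hk' : ∀ k, k ≠ o → k ≠ i → k ≠ j → (Φ u).1 k o = 0 := fun k h2 h3 h4 => by
    rw [← State.star_apply, hk k h2 h3 h4, star_zero]
  have hku : ∀ k, k ≠ o → k ≠ i → k ≠ j → u.1 o k = 0 := fun k h2 h3 h4 => by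
    rw [hu, threeLevel_apply hi hj hij h1]
    simp [threeLevelVec, h2, h3, h4]
  have hku' : ∀ k, k ≠ o → k ≠ i → k ≠ j → u.1 k o = 0 := fun k h2 h3 h4 => by
    rw [← State.star_apply, hku k h2 h3 h4, star_zero]
  -- The vectors `(1, 1, 1)` and `(1, I, I)` have inner product `1 + 2I`. Conjugating only the `j`
  -- contribution turns it into `1 + I - I = 1`, so the overlap would drop from `5/9` to `1/9`.
  have t1 := pu.trace_mul pv o
  have t2 := (h.isPure pu).trace_mul (h.isPure pv) o
  rw [h.trace pu, hd, hd, t1,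
    sum_eq_triple hi hj hij _ fun k h2 h3 h4 => by rw [hku' k h2 h3 h4, zero_mul],
    sum_eq_triple hi hj hij _ fun k h2 h3 h4 => by rw [hku k h2 h3 h4, zero_mul],
    sum_eq_triple hi hj hij _ fun k h2 h3 h4 => by rw [hk' k h2 h3 h4, zero_mul],
    sum_eq_triple hi hj hij _ fun k h2 h3 h4 => by rw [hk k h2 h3 h4, zero_mul]] at t2
  simp only [hd, eA, eB, eA', eB'] at t2
  have r1 : ∀ x y : ℂ, a * x * (star a * y) = x * y := fun x y => by
    linear_combination x * y * ha'
  have r2 : ∀ x y : ℂ, star a * x * (a * y) = x * y := fun x y => by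
    linear_combination x * y * ha'
  have r3 : ∀ x y : ℂ, b * x * (star b * y) = x * y := fun x y => by
    linear_combination x * y * hb'
  have r4 : ∀ x y : ℂ, star b * x * (b * y) = x * y := fun x y => by
    linear_combination x * y * hb'
  simp only [r1, r2, r3, r4, hu, hv, threeLevel_apply hi hj hij h1,
    threeLevel_apply hi hj hij hI] at t2
  simp only [threeLevelVec, hi, hj, hij.symm, if_true, if_false, star_one, Complex.star_def,
    Complex.conj_I] at t2
  have t3 := congrArg Complex.re t2
  norm_num at t3

end DiagonalPreserving

end QubitWasserstein

namespace QubitWasserstein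

/-! ### Assembling the phases into a diagonal unitary -/

section WignerTheorem

variable {ι : Type} [Fintype ι] [DecidableEq ι] {Φ : State ι → State ι}

lemma PreservesOverlap.exists_phases (h : PreservesOverlap Φ)
    (hd : ∀ ω i, (Φ ω).1 i i = ω.1 i i) (o : ι) :
    ∃ c : ι → ℂ, (∀ j, star (c j) * c j = 1) ∧
      ((∀ ω j, (Φ ω).1 o j = c o * ω.1 o j * star (c j)) ∨
        ∀ ω j, (Φ ω).1 o j = c o * ω.1 j o * star (c j)) := by
  have key : ∀ j, ∃ c : ℂ, Complex.normSq c = 1 ∧ (j = o → c = 1) ∧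
      ((∀ ω, c * (Φ ω).1 o j = ω.1 o j) ∨ ∀ ω, c * (Φ ω).1 o j = ω.1 j o) := by
    intro j
    by_cases hj : j = o
    · subst hj
      exact ⟨1, by simp, fun _ => rfl, Or.inl fun ω => by rw [hd, one_mul]⟩
    · obtain ⟨c, hc, hAB⟩ := h.exists_phase hd hj
      exact ⟨c, hc, fun h => absurd h hj, hAB⟩
  choose c hc hco hAB using key
  have hc' : ∀ j, star (c j) * c j = 1 := fun j => by
    have h1 := Complex.normSq_eq_conj_mul_self (z := c j)
    rw [hc] at h1
    exact_mod_cast h1.symm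
  have solve : ∀ j (x y : ℂ), c j * x = y → x = c o * y * star (c j) := by
    intro j x y hxy
    rw [hco o rfl, ← hxy]
    linear_combination -x * hc' j
  refine ⟨c, hc', ?_⟩
  -- If both alternatives fail, some entry `j` is not kept, hence conjugated, and some entry `i` is
  -- not conjugated, hence kept; this is the mixed case already excluded.
  by_contra! hcon
  obtain ⟨⟨ω, j, hω⟩, τ, i, hτ⟩ := hcon
  have hB : ∀ ω, c j * (Φ ω).1 o j = ω.1 j o :=
    (hAB j).resolve_left fun hA => hω (solve j _ _ (hA ω))
  have hA : ∀ ω, c i * (Φ ω).1 o i = ω.1 o i :=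
    (hAB i).resolve_right fun hB => hτ (solve i _ _ (hB τ))
  have hj : j ≠ o := by
    rintro rfl
    refine hω (solve _ _ _ ?_)
    rw [hd, hco _ rfl, one_mul]
  have hi : i ≠ o := by
    rintro rfl
    refine hτ (solve _ _ _ ?_)
    rw [hd, hco _ rfl, one_mul]
  have hij : i ≠ j := by
    rintro rfl
    exact hτ (solve _ _ _ ((hA τ).trans ((hA τ).symm.trans (hB τ))))
  exact h.phase_consistent hd hi hj hij (hc i) (hc j) hA hB

lemma conj_diagonal_apply (c : ι → ℂ) (X : Matrix ι ι ℂ) (i j : ι) :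
    (Matrix.diagonal c * X * (Matrix.diagonal c)ᴴ) i j = c i * X i j * star (c j) := by
  rw [Matrix.diagonal_conjTranspose, Matrix.mul_diagonal, Matrix.diagonal_mul]
  rfl

/-- Maps that preserve diagonals and overlaps are implemented by diagonal (anti-)unitaries. -/
lemma PreservesOverlap.exists_diagonal [Nonempty ι] (h : PreservesOverlap Φ)
    (hd : ∀ ω i, (Φ ω).1 i i = ω.1 i i) :
    ∃ W ∈ Matrix.unitaryGroup ι ℂ, (∀ ω, (Φ ω).1 = W * ω.1 * Wᴴ) ∨
      ∀ ω, (Φ ω).1 = W * ω.1ᵀ * Wᴴ := by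
  obtain ⟨o⟩ := ‹Nonempty ι›
  obtain ⟨c, hc, hAB⟩ := h.exists_phases hd o
  set W := Matrix.diagonal c with hW
  have hWu : W ∈ Matrix.unitaryGroup ι ℂ := by
    rw [Matrix.mem_unitaryGroup_iff', hW, Matrix.star_eq_conjTranspose,
      Matrix.diagonal_conjTranspose, Matrix.diagonal_mul_diagonal, ← Matrix.diagonal_one]
    congr 1
    ext j
    exact hc j
  have hWW : Wᴴ * W = 1 := Matrix.mem_unitaryGroup_iff'.1 hWu
  have hWW' : W * Wᴴ = 1 := Matrix.mem_unitaryGroup_iff.1 hWu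
  have cancel : ∀ X Y : Matrix ι ι ℂ, Wᴴ * X * W = Y → X = W * Y * Wᴴ := by
    rintro X _ rfl
    rw [show W * (Wᴴ * X * W) * Wᴴ = (W * Wᴴ) * X * (W * Wᴴ) by simp only [Matrix.mul_assoc],
      hWW', Matrix.one_mul, Matrix.mul_one]
  have cyc : ∀ X Y : Matrix ι ι ℂ, (W * X * Wᴴ * Y).trace = (X * (Wᴴ * Y * W)).trace := by
    intro X Y
    rw [Matrix.mul_assoc, Matrix.mul_assoc, Matrix.trace_mul_comm]
    simp only [Matrix.mul_assoc]
  refine ⟨W, hWu, hAB.imp (fun hA => ?_) fun hB => ?_⟩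
  -- Vanishing minors recover `ρ i j` from `ρ i o`, `ρ o j` and `ρ o o`, so the formula for row `o`
  -- extends to the whole matrix.
  · have pure_eq : ∀ ρ : State ι, IsPure ρ → ρ.1 o o ≠ 0 → (Φ ρ).1 = W * ρ.1 * Wᴴ := by
      intro ρ hρ ho
      ext i j
      rw [conj_diagonal_apply]
      refine mul_right_cancel₀ ho ?_
      have h1 := (h.isPure hρ).mul_apply i j o o
      have h2 := hρ.mul_apply i j o o
      rw [hd, ← (Φ ρ).star_apply o i, hA, hA, star_mul', star_mul', star_star,
        ρ.star_apply] at h1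
      rw [h1]
      linear_combination ρ.1 i o * c i * ρ.1 o j * star (c j) * hc o - c i * star (c j) * h2
    intro ω
    -- For general `ω`, the matrix `Wᴴ (Φ ω) W` has the same overlaps as `ω` with every pure state
    -- not orthogonal to `e_o`.
    refine cancel _ _ (ext_of_trace_pureState o fun ρ hρ ho => ?_)
    rw [← h.trace hρ, pure_eq ρ hρ ho, cyc]
  · have pure_eq : ∀ ρ : State ι, IsPure ρ → ρ.1 o o ≠ 0 → (Φ ρ).1 = W * ρ.1ᵀ * Wᴴ := by
      intro ρ hρ ho
      ext i j
      rw [conj_diagonal_apply, Matrix.transpose_apply]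
      refine mul_right_cancel₀ ho ?_
      have h1 := (h.isPure hρ).mul_apply i j o o
      have h2 := hρ.mul_apply j i o o
      rw [hd, ← (Φ ρ).star_apply o i, hB, hB, star_mul', star_mul', star_star,
        ρ.star_apply] at h1
      rw [h1]
      linear_combination ρ.1 o i * c i * ρ.1 j o * star (c j) * hc o - c i * star (c j) * h2
    intro ω
    refine cancel _ _ (Matrix.transpose_injective ?_)
    rw [Matrix.transpose_transpose]
    refine ext_of_trace_pureState o fun ρ hρ ho => ?_
    rw [← h.trace hρ, pure_eq ρ hρ ho, cyc, ← Matrix.trace_transpose, Matrix.transpose_mul,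
      Matrix.transpose_transpose, Matrix.trace_mul_comm]

/-- **Wigner's theorem** for maps of the state space of a finite-dimensional Hilbert space. -/
theorem PreservesOverlap.exists_unitary [Nonempty ι] (h : PreservesOverlap Φ) :
    ∃ W ∈ Matrix.unitaryGroup ι ℂ, (∀ ω, (Φ ω).1 = W * ω.1 * Wᴴ) ∨
      ∀ ω, (Φ ω).1 = W * ω.1ᵀ * Wᴴ := by
  obtain ⟨V, hV, hdiag⟩ := h.exists_unitary_diag
  have hV' : Vᴴ ∈ Matrix.unitaryGroup ι ℂ := Unitary.star_mem hV
  have hVV : V * Vᴴ = 1 := Matrix.mem_unitaryGroup_iff.1 hV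
  have hconj : ∀ ω, ((Φ ω).conj hV').1 = Vᴴ * (Φ ω).1 * V := fun ω => by
    simp [State.conj]
  have back : ∀ (W X Y : Matrix ι ι ℂ), Vᴴ * X * V = W * Y * Wᴴ →
      X = V * W * Y * (V * W)ᴴ := by
    intro W X Y hXY
    calc X = (V * Vᴴ) * X * (V * Vᴴ) := by rw [hVV, Matrix.one_mul, Matrix.mul_one]
      _ = V * (Vᴴ * X * V) * Vᴴ := by simp only [Matrix.mul_assoc]
      _ = V * W * Y * (V * W)ᴴ := by
        rw [hXY, Matrix.conjTranspose_mul]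
        simp only [Matrix.mul_assoc]
  obtain ⟨W, hW, hAB⟩ := (h.conj hV').exists_diagonal fun ω i => by rw [hconj, hdiag]
  refine ⟨V * W, mul_mem hV hW, hAB.imp (fun hA ω => ?_) fun hB ω => ?_⟩
  · exact back _ _ _ (by rw [← hconj, hA])
  · exact back _ _ _ (by rw [← hconj, hB])

end WignerTheorem

/-! ### Invariance of the distance under unitaries and transposition -/

section Invariance

variable {ι : Type} [Fintype ι] [DecidableEq ι]

/-- The transposed (equivalently, complex conjugated) state. -/
def State.transpose {κ : Type} [Fintype κ] (ρ : State κ) : State κ :=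
  ⟨ρ.1ᵀ, ρ.2.1.transpose, by rw [Matrix.trace_transpose, ρ.2.2]⟩

omit [DecidableEq ι] in
lemma transpose_mem_couplings {ρ ω : State ι} {P : State (ι × ι)} (hP : P ∈ couplings ρ ω) :
    P.transpose ∈ couplings ρ.transpose ω.transpose :=
  ⟨congrArg Matrix.transpose hP.1, congrArg Matrix.transpose hP.2⟩

omit [DecidableEq ι] in
lemma overlap_transpose (P : Matrix (ι × ι) (ι × ι) ℂ) : overlap Pᵀ = overlap P :=
  Finset.sum_comm

lemma kronecker_mem_unitaryGroup {W : Matrix ι ι ℂ} (hW : W ∈ Matrix.unitaryGroup ι ℂ) :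
    W ⊗ₖ Wᴴᵀ ∈ Matrix.unitaryGroup (ι × ι) ℂ := by
  have h : Wᴴ * W = 1 := Matrix.mem_unitaryGroup_iff'.1 hW
  have h1 : Wᴴᵀᴴ = Wᵀ := by ext; simp
  rw [Matrix.mem_unitaryGroup_iff', Matrix.star_eq_conjTranspose, Matrix.conjTranspose_kronecker,
    ← Matrix.mul_kronecker_mul, h, h1, ← Matrix.transpose_mul, h, Matrix.transpose_one,
    Matrix.one_kronecker_one]

/-- Partial trace is dual to `X ↦ X ⊗ I`; marginals can thus be compared by testing against all `X`.
-/
lemma trace_mul_kronecker_one (P : Matrix (ι × ι) (ι × ι) ℂ) (X : Matrix ι ι ℂ) :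
    (P * (X ⊗ₖ (1 : Matrix ι ι ℂ))).trace = (partialTraceSnd P * X).trace := by
  simp only [Matrix.trace, Matrix.diag_apply, Matrix.mul_apply, Fintype.sum_prod_type,
    Matrix.kroneckerMap_apply, Matrix.one_apply, mul_ite, mul_one, mul_zero,
    Finset.sum_ite_eq', Finset.mem_univ, if_true, partialTraceSnd, Matrix.of_apply,
    Finset.sum_mul]
  exact Finset.sum_congr rfl fun i _ => Finset.sum_comm

lemma trace_mul_one_kronecker (P : Matrix (ι × ι) (ι × ι) ℂ) (X : Matrix ι ι ℂ) :
    (P * ((1 : Matrix ι ι ℂ) ⊗ₖ X)).trace = (partialTraceFst P * X).trace := by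
  have h : ∀ i j, (P * ((1 : Matrix ι ι ℂ) ⊗ₖ X)) (i, j) (i, j) =
      ∑ l, P (i, j) (i, l) * X l j := by
    intro i j
    simp [Matrix.mul_apply, Fintype.sum_prod_type, Matrix.one_apply, Finset.sum_ite_irrel]
  simp only [Matrix.trace, Matrix.diag_apply, Fintype.sum_prod_type, h]
  simp only [Matrix.mul_apply, partialTraceFst, Matrix.of_apply, Finset.sum_mul]
  rw [Finset.sum_comm]
  exact Finset.sum_congr rfl fun j _ => Finset.sum_comm

lemma trace_conj_mul {κ : Type} [Fintype κ] (K P X : Matrix κ κ ℂ) :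
    (K * P * Kᴴ * X).trace = (P * (Kᴴ * X * K)).trace := by
  rw [Matrix.mul_assoc, Matrix.mul_assoc, Matrix.trace_mul_comm]
  simp only [Matrix.mul_assoc]

lemma conj_mem_couplings {W : Matrix ι ι ℂ} (hW : W ∈ Matrix.unitaryGroup ι ℂ) {ρ ω : State ι}
    {P : State (ι × ι)} (hP : P ∈ couplings ρ ω) :
    P.conj (kronecker_mem_unitaryGroup hW) ∈ couplings (ρ.conj hW) (ω.conj hW) := by
  have h : Wᴴ * W = 1 := Matrix.mem_unitaryGroup_iff'.1 hW
  have h1 : Wᴴᵀᴴ = Wᵀ := by ext; simp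
  constructor
  · refine Matrix.ext_iff_trace_mul_right.2 fun X => ?_
    rw [← trace_mul_kronecker_one]
    simp only [State.conj]
    rw [trace_conj_mul, trace_conj_mul, Matrix.conjTranspose_kronecker,
      ← Matrix.mul_kronecker_mul, ← Matrix.mul_kronecker_mul, Matrix.mul_one, h1,
      ← Matrix.transpose_mul, h, Matrix.transpose_one, trace_mul_kronecker_one, hP.1]
  · refine Matrix.ext_iff_trace_mul_right.2 fun X => ?_
    rw [← trace_mul_one_kronecker]
    simp only [State.conj]
    have h2 : (W * ρ.1 * Wᴴ)ᵀ = Wᴴᵀ * ρ.1ᵀ * Wᴴᵀᴴ := by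
      rw [h1, Matrix.transpose_mul, Matrix.transpose_mul, Matrix.mul_assoc]
    rw [h2, trace_conj_mul, trace_conj_mul, Matrix.conjTranspose_kronecker,
      ← Matrix.mul_kronecker_mul, ← Matrix.mul_kronecker_mul, Matrix.mul_one, h,
      trace_mul_one_kronecker, hP.2]

lemma overlap_eq_dotProduct (P : Matrix (ι × ι) (ι × ι) ℂ) :
    overlap P = star (fun p : ι × ι => (1 : Matrix ι ι ℂ) p.1 p.2) ⬝ᵥ
      P *ᵥ fun p => (1 : Matrix ι ι ℂ) p.1 p.2 := by
  simp [overlap, dotProduct, Matrix.mulVec, Fintype.sum_prod_type, Matrix.one_apply, apply_ite]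

/-- In coordinates, `(W ⊗ W̄)ᴴ Ω = Ω` is the identity `Wᴴ W = 1`, where `W̄` is `Wᴴᵀ`. -/
lemma overlap_conj {W : Matrix ι ι ℂ} (hW : W ∈ Matrix.unitaryGroup ι ℂ)
    (P : State (ι × ι)) :
    overlap (P.conj (kronecker_mem_unitaryGroup hW)).1 = overlap P.1 := by
  have h : Wᴴ * W = 1 := Matrix.mem_unitaryGroup_iff'.1 hW
  set Ω : ι × ι → ℂ := fun p => (1 : Matrix ι ι ℂ) p.1 p.2 with hΩ
  set K := W ⊗ₖ Wᴴᵀ with hK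
  have hKΩ : Kᴴ *ᵥ Ω = Ω := by
    ext ⟨i, j⟩
    have h2 := congrFun (congrFun h i) j
    rw [Matrix.mul_apply] at h2
    simp only [hΩ]
    rw [← h2]
    simp [hK, Matrix.mulVec, dotProduct, Fintype.sum_prod_type, Matrix.one_apply]
  rw [overlap_eq_dotProduct, overlap_eq_dotProduct]
  change star Ω ⬝ᵥ (K * P.1 * Kᴴ) *ᵥ Ω = star Ω ⬝ᵥ P.1 *ᵥ Ω
  rw [← Matrix.mulVec_mulVec, hKΩ, ← Matrix.mulVec_mulVec, Matrix.dotProduct_mulVec]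
  have h3 : star Ω ᵥ* K = star Ω := by
    have h4 := congrArg star hKΩ
    rwa [Matrix.star_mulVec, Matrix.conjTranspose_conjTranspose] at h4
  rw [h3]

lemma State.conj_conj_star {W : Matrix ι ι ℂ} (hW : W ∈ Matrix.unitaryGroup ι ℂ)
    (hW' : Wᴴ ∈ Matrix.unitaryGroup ι ℂ) (ρ : State ι) : (ρ.conj hW).conj hW' = ρ := by
  have h : Wᴴ * W = 1 := Matrix.mem_unitaryGroup_iff'.1 hW
  apply Subtype.ext
  simp only [State.conj, Matrix.conjTranspose_conjTranspose]
  rw [show Wᴴ * (W * ρ.1 * Wᴴ) * W = (Wᴴ * W) * ρ.1 * (Wᴴ * W) by simp only [Matrix.mul_assoc],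
    h, Matrix.one_mul, Matrix.mul_one]

variable {n : ℕ}

lemma image_cost_conj_subset {W : Matrix (Bits n) (Bits n) ℂ}
    (hW : W ∈ Matrix.unitaryGroup (Bits n) ℂ) (ρ ω : State (Bits n)) :
    cost (pauliTensor (n := n)) '' couplings ρ ω ⊆
      cost (pauliTensor (n := n)) '' couplings (ρ.conj hW) (ω.conj hW) := by
  rintro _ ⟨P, hP, rfl⟩
  exact ⟨_, conj_mem_couplings hW hP, by rw [cost_pauliTensor, cost_pauliTensor, overlap_conj hW]⟩

lemma symDist_conj {W : Matrix (Bits n) (Bits n) ℂ}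
    (hW : W ∈ Matrix.unitaryGroup (Bits n) ℂ) (ρ ω : State (Bits n)) :
    symDist n (ρ.conj hW) (ω.conj hW) = symDist n ρ ω := by
  have hW' : Wᴴ ∈ Matrix.unitaryGroup (Bits n) ℂ := Unitary.star_mem hW
  -- Conjugating back by `Wᴴ` gives the reverse inclusion, so the two sets of costs coincide and no
  -- minimiser is needed.
  have h := image_cost_conj_subset hW' (ρ.conj hW) (ω.conj hW)
  rw [State.conj_conj_star, State.conj_conj_star] at h
  rw [symDist, wassersteinDist, h.antisymm (image_cost_conj_subset hW ρ ω), symDist,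
    wassersteinDist]

lemma image_cost_transpose_subset (ρ ω : State (Bits n)) :
    cost (pauliTensor (n := n)) '' couplings ρ ω ⊆
      cost (pauliTensor (n := n)) '' couplings ρ.transpose ω.transpose := by
  rintro _ ⟨P, hP, rfl⟩
  refine ⟨_, transpose_mem_couplings hP, ?_⟩
  rw [cost_pauliTensor, cost_pauliTensor, State.transpose, overlap_transpose]

lemma symDist_transpose (ρ ω : State (Bits n)) :
    symDist n ρ.transpose ω.transpose = symDist n ρ ω := by
  have h : cost (pauliTensor (n := n)) '' couplings ρ.transpose ω.transpose ⊆
      cost (pauliTensor (n := n)) '' couplings ρ ω :=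
    image_cost_transpose_subset ρ.transpose ω.transpose
  rw [symDist, wassersteinDist, h.antisymm (image_cost_transpose_subset ρ ω), symDist,
    wassersteinDist]

end Invariance

end QubitWasserstein

namespace QubitWasserstein

/-! ### Unitary and anti-unitary operators as matrices -/

section Implementation

variable {ι : Type} [Fintype ι] [DecidableEq ι]

lemma sqNorm_mulVec {W : Matrix ι ι ℂ} (hW : W ∈ Matrix.unitaryGroup ι ℂ) (v : ι → ℂ) :
    sqNorm (W *ᵥ v) = sqNorm v := by
  have h : Wᴴ * W = 1 := Matrix.mem_unitaryGroup_iff'.1 hW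
  have h1 := star_dotProduct_self (W *ᵥ v)
  rw [Matrix.star_mulVec, Matrix.dotProduct_mulVec, Matrix.vecMul_vecMul, h, Matrix.vecMul_one,
    star_dotProduct_self] at h1
  exact_mod_cast h1.symm

omit [DecidableEq ι] in
lemma norm_toLp_eq_sqrt (v : ι → ℂ) : ‖WithLp.toLp 2 v‖ = √(sqNorm v) := by
  simp [EuclideanSpace.norm_eq, sqNorm, Complex.normSq_eq_norm_sq]

/-- The unitary operator given by a unitary matrix. -/
noncomputable def unitaryIsometry {W : Matrix ι ι ℂ} (hW : W ∈ Matrix.unitaryGroup ι ℂ) :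
    EuclideanSpace ℂ ι ≃ₗᵢ[ℂ] EuclideanSpace ℂ ι where
  toFun x := WithLp.toLp 2 (W *ᵥ x.ofLp)
  invFun x := WithLp.toLp 2 (Wᴴ *ᵥ x.ofLp)
  map_add' x y := by simp [Matrix.mulVec_add]
  map_smul' c x := by simp [Matrix.mulVec_smul]
  left_inv x := by
    have h : Wᴴ * W = 1 := Matrix.mem_unitaryGroup_iff'.1 hW
    simp [h]
  right_inv x := by
    have h : W * Wᴴ = 1 := Matrix.mem_unitaryGroup_iff.1 hW
    simp [h]
  norm_map' x := by
    change ‖WithLp.toLp 2 (W *ᵥ x.ofLp)‖ = ‖WithLp.toLp 2 x.ofLp‖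
    rw [norm_toLp_eq_sqrt, norm_toLp_eq_sqrt, sqNorm_mulVec hW]

/-- Coordinatewise complex conjugation. -/
noncomputable def conjIsometry (ι : Type) [Fintype ι] :
    EuclideanSpace ℂ ι ≃ₗᵢ⋆[ℂ] EuclideanSpace ℂ ι where
  toFun x := WithLp.toLp 2 (star x.ofLp)
  invFun x := WithLp.toLp 2 (star x.ofLp)
  map_add' x y := by simp
  map_smul' c x := by
    ext i
    simp
  left_inv x := by simp
  right_inv x := by simp
  norm_map' x := by
    simp [EuclideanSpace.norm_eq]

lemma exists_eq_unitaryIsometry (U : EuclideanSpace ℂ ι ≃ₗᵢ[ℂ] EuclideanSpace ℂ ι) :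
    ∃ (W : Matrix ι ι ℂ) (hW : W ∈ Matrix.unitaryGroup ι ℂ), U = unitaryIsometry hW := by
  obtain ⟨W, hW⟩ := Matrix.toEuclideanLin.surjective U.toLinearEquiv.toLinearMap
  have hU : ∀ x, U x = WithLp.toLp 2 (W *ᵥ x.ofLp) := fun x => by
    have h1 := LinearMap.congr_fun hW x
    exact h1.symm
  have hWu : W ∈ Matrix.unitaryGroup ι ℂ := by
    rw [Matrix.mem_unitaryGroup_iff']
    ext i j
    have h1 := U.inner_map_map (EuclideanSpace.single i 1) (EuclideanSpace.single j 1)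
    have h2 : ∀ k, U (EuclideanSpace.single k 1) = WithLp.toLp 2 fun l => W l k := fun k => by
      rw [hU]
      congr 1
      exact Matrix.mulVec_single_one W k
    rw [h2, h2, EuclideanSpace.inner_eq_star_dotProduct, dotProduct_comm,
      EuclideanSpace.inner_single_left] at h1
    refine Eq.trans h1 ?_
    simp [Matrix.one_apply]
  exact ⟨W, hWu, LinearIsometryEquiv.ext hU⟩

omit [DecidableEq ι] in
lemma matrix_eq_iff_mulVec {X Y : Matrix ι ι ℂ} : X = Y ↔ ∀ v, X *ᵥ v = Y *ᵥ v :=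
  ⟨fun h v => by rw [h], fun h => Matrix.mulVec_injective (funext h)⟩

lemma op_eq_unitaryIsometry_iff {W : Matrix ι ι ℂ} (hW : W ∈ Matrix.unitaryGroup ι ℂ)
    (ρ τ : State ι) :
    (∀ x, τ.op x = unitaryIsometry hW (ρ.op ((unitaryIsometry hW).symm x))) ↔
      τ.1 = W * ρ.1 * Wᴴ := by
  have key : ∀ v : ι → ℂ, τ.op (WithLp.toLp 2 v) =
      unitaryIsometry hW (ρ.op ((unitaryIsometry hW).symm (WithLp.toLp 2 v))) ↔
      τ.1 *ᵥ v = (W * ρ.1 * Wᴴ) *ᵥ v := by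
    intro v
    have h1 : unitaryIsometry hW (ρ.op ((unitaryIsometry hW).symm (WithLp.toLp 2 v))) =
      WithLp.toLp 2 (W *ᵥ ρ.1 *ᵥ Wᴴ *ᵥ v) := rfl
    have h2 : τ.op (WithLp.toLp 2 v) = WithLp.toLp 2 (τ.1 *ᵥ v) := rfl
    rw [h1, h2, (WithLp.toLp_injective 2).eq_iff, Matrix.mulVec_mulVec, Matrix.mulVec_mulVec,
      Matrix.mul_assoc]
  rw [matrix_eq_iff_mulVec]
  exact ⟨fun h v => (key v).1 (h _), fun h x => (key x.ofLp).2 (h _)⟩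

lemma op_eq_conjIsometry_trans_iff {W : Matrix ι ι ℂ} (hW : W ∈ Matrix.unitaryGroup ι ℂ)
    (ρ τ : State ι) :
    (∀ x, τ.op x = ((conjIsometry ι).trans (unitaryIsometry hW))
      (ρ.op (((conjIsometry ι).trans (unitaryIsometry hW)).symm x))) ↔
      τ.1 = W * ρ.1ᵀ * Wᴴ := by
  -- Conjugating a Hermitian matrix by coordinatewise complex conjugation transposes it.
  have hconj : ∀ v, star (ρ.1 *ᵥ star v) = ρ.1ᵀ *ᵥ v := by
    intro v
    rw [Matrix.star_mulVec, star_star, ρ.2.1.isHermitian.eq, Matrix.mulVec_transpose]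
  have key : ∀ v : ι → ℂ, τ.op (WithLp.toLp 2 v) = ((conjIsometry ι).trans (unitaryIsometry hW))
      (ρ.op (((conjIsometry ι).trans (unitaryIsometry hW)).symm (WithLp.toLp 2 v))) ↔
      τ.1 *ᵥ v = (W * ρ.1ᵀ * Wᴴ) *ᵥ v := by
    intro v
    have h1 : ((conjIsometry ι).trans (unitaryIsometry hW))
        (ρ.op (((conjIsometry ι).trans (unitaryIsometry hW)).symm (WithLp.toLp 2 v))) =
      WithLp.toLp 2 (W *ᵥ star (ρ.1 *ᵥ star (Wᴴ *ᵥ v))) := rfl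
    have h2 : τ.op (WithLp.toLp 2 v) = WithLp.toLp 2 (τ.1 *ᵥ v) := rfl
    rw [h1, h2, (WithLp.toLp_injective 2).eq_iff, hconj, Matrix.mulVec_mulVec,
      Matrix.mulVec_mulVec, Matrix.mul_assoc]
  rw [matrix_eq_iff_mulVec]
  exact ⟨fun h v => (key v).1 (h _), fun h x => (key x.ofLp).2 (h _)⟩

lemma isWignerSymmetry_iff {n : ℕ} (Φ : State (Bits n) → State (Bits n)) :
    IsWignerSymmetry Φ ↔ ∃ W ∈ Matrix.unitaryGroup (Bits n) ℂ,
      (∀ ω, (Φ ω).1 = W * ω.1 * Wᴴ) ∨ ∀ ω, (Φ ω).1 = W * ω.1ᵀ * Wᴴ := by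
  constructor
  · rintro (⟨U, hU⟩ | ⟨U, hU⟩)
    · obtain ⟨W, hW, rfl⟩ := exists_eq_unitaryIsometry U
      exact ⟨W, hW, Or.inl fun ω => (op_eq_unitaryIsometry_iff hW _ _).1 (hU ω)⟩
    -- An anti-unitary precomposed with coordinatewise conjugation is complex linear, hence given by
    -- a unitary matrix.
    · obtain ⟨W, hW, h⟩ := exists_eq_unitaryIsometry ((conjIsometry (Bits n)).trans U)
      have hU' : U = (conjIsometry (Bits n)).trans (unitaryIsometry hW) := by
        rw [← h]
        ext1 x
        exact congrArg U (LinearIsometryEquiv.apply_symm_apply (conjIsometry (Bits n)) x).symm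
      subst hU'
      exact ⟨W, hW, Or.inr fun ω => (op_eq_conjIsometry_trans_iff hW _ _).1 (hU ω)⟩
  · rintro ⟨W, hW, h | h⟩
    · exact Or.inl ⟨unitaryIsometry hW, fun ω => (op_eq_unitaryIsometry_iff hW _ _).2 (h ω)⟩
    · exact Or.inr ⟨(conjIsometry (Bits n)).trans (unitaryIsometry hW),
        fun ω => (op_eq_conjIsometry_trans_iff hW _ _).2 (h ω)⟩

end Implementation

end QubitWasserstein

theorem theorem1 (n : ℕ)
    (Φ : QubitWasserstein.State (QubitWasserstein.Bits n) →
      QubitWasserstein.State (QubitWasserstein.Bits n)) :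
    (∀ ρ ω : QubitWasserstein.State (QubitWasserstein.Bits n),
      QubitWasserstein.symDist n (Φ ρ) (Φ ω) = QubitWasserstein.symDist n ρ ω) ↔
    QubitWasserstein.IsWignerSymmetry Φ := by
  rw [QubitWasserstein.isWignerSymmetry_iff]
  constructor
  · intro h
    have hΦ : QubitWasserstein.PreservesOverlap Φ :=
      ⟨QubitWasserstein.isPure_map_of_isometry h, QubitWasserstein.trace_map_mul_of_isometry h⟩
    exact hΦ.exists_unitary
  · rintro ⟨W, hW, h | h⟩ ρ ω
    · have hΦ : ∀ ρ, Φ ρ = ρ.conj hW := fun ρ => Subtype.ext (h ρ)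
      rw [hΦ, hΦ, QubitWasserstein.symDist_conj]
    · have hΦ : ∀ ρ, Φ ρ = ρ.transpose.conj hW := fun ρ => Subtype.ext (h ρ)
      rw [hΦ, hΦ, QubitWasserstein.symDist_conj, QubitWasserstein.symDist_transpose]
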